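/- Let $G$ be a regular undirected graph on $n$ vertices with positive degree (self-loops and nonnegative symmetric edge weights are allowed), and denote also by $G$ its random walk matrix, i.e. the adjacency matrix divided by the degree. For a nonempty set $S$ of vertices let $1_S\in\{0,1\}^n$ be its indicator vector and $\Phi_G(S)=1-\langle 1_S,G1_S\rangle/|S|$ its expansion. A level set of a vector $x\in\mathbb{R}_{\ge 0}^n$ is a set of the form $\{i : x_i\ge\tau\}$ with $\tau>0$. There are universal constants $c,C>0$ such that the following holds for every such $n$ and $G$, and every $0<\delta\le 1/2$. Let $v\in\mathbb{R}^n$ be a unit vector ($\|v\|_2=1$) in the span of the eigenvectors of $G$ with eigenvalue at least $1/2$, and suppose that $\|v\|_4^4=\sum_i |v_i|^4\ge \frac{1}{\delta n}$. Then there is a nonempty level set $S$ of the vector $w$, $w_i=|v_i|$, with the following property: for some integer $0\le t\le C\log n$ there is a nonempty level set $T$ of $G^t1_S+G^{t+1}1_S$ with $|T|\le C\,\delta\log(1/\delta)\,n$ and $\Phi_G(T)\le 1-c$. -/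

import Mathlib

open scoped Matrix

/-- A finite undirected graph on the vertex set `V`, in the general form with nonnegative
symmetric edge weights; parallel edges (as integer weights) and self-loops are allowed. -/
structure WGraph (V : Type) where
  /-- the weight of the edge between two vertices; `0` means that there is no edge -/
  weight : V → V → ℝ
  weight_nonneg : ∀ i j, 0 ≤ weight i j
  weight_symm : ∀ i j, weight i j = weight j i

namespace WGraph

variable {V : Type} [Fintype V]

/-- The (weighted) degree of a vertex. -/
noncomputable def degree (G : WGraph V) (i : V) : ℝ := ∑ j, G.weight i j

/-- All vertices have the same positive degree. -/
def IsRegular (G : WGraph V) : Prop := ∃ d : ℝ, 0 < d ∧ ∀ i, G.degree i = d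

/-- The random walk matrix; for a regular graph this is the normalized adjacency matrix. -/
noncomputable def walkMatrix (G : WGraph V) : Matrix V V ℝ :=
  Matrix.of fun i j => G.weight i j / G.degree i

/-- The span of the eigenvectors of the random walk matrix with eigenvalue at least `a`. -/
noncomputable def highEigenspan [DecidableEq V] (G : WGraph V) (a : ℝ) :
    Submodule ℝ (V → ℝ) :=
  Submodule.span ℝ
    {u | ∃ μ : ℝ, a ≤ μ ∧ Module.End.HasEigenvector (Matrix.toLin' G.walkMatrix) μ u}

/-- The `0/1` indicator vector of a set of vertices. -/
noncomputable def ind [DecidableEq V] (S : Finset V) : V → ℝ := fun i => if i ∈ S then 1 else 0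

/-- The expansion `1 - ⟨1_S, G 1_S⟩ / |S|` of a (nonempty) set of vertices. -/
noncomputable def expansion [DecidableEq V] (G : WGraph V) (S : Finset V) : ℝ :=
  1 - (ind S ⬝ᵥ (G.walkMatrix *ᵥ ind S)) / (S.card : ℝ)

/-- `S` is a level set `{i : x i ≥ τ}`, for a threshold `τ > 0`, of the vector `x`
(which is entrywise nonnegative wherever this is used). -/
def IsLevelSet (x : V → ℝ) (S : Finset V) : Prop :=
  ∃ τ : ℝ, 0 < τ ∧ ∀ i, i ∈ S ↔ τ ≤ x i

/-- A simple graph, with all edges of weight one. -/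
noncomputable def ofSimpleGraph (H : SimpleGraph V) [DecidableRel H.Adj] : WGraph V where
  weight i j := H.adjMatrix ℝ i j
  weight_nonneg i j := by
    rw [SimpleGraph.adjMatrix_apply]; split_ifs <;> norm_num
  weight_symm i j := by
    simp only [SimpleGraph.adjMatrix_apply, H.adj_comm]

theorem ofSimpleGraph_degree (H : SimpleGraph V) [DecidableRel H.Adj] (i : V) :
    (ofSimpleGraph H).degree i = (H.degree i : ℝ) := by
  simp [degree, ofSimpleGraph, SimpleGraph.adjMatrix_apply, ← SimpleGraph.card_neighborFinset_eq_degree,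
    SimpleGraph.neighborFinset_eq_filter]

theorem ofSimpleGraph_isRegular (H : SimpleGraph V) [DecidableRel H.Adj] {d : ℕ} (hd : 0 < d)
    (h : H.IsRegularOfDegree d) : (ofSimpleGraph H).IsRegular :=
  ⟨d, by exact_mod_cast hd, fun i => by rw [ofSimpleGraph_degree, h i]⟩

theorem ofSimpleGraph_walkMatrix (H : SimpleGraph V) [DecidableRel H.Adj] {d : ℕ}
    (h : H.IsRegularOfDegree d) :
    (ofSimpleGraph H).walkMatrix = (d : ℝ)⁻¹ • H.adjMatrix ℝ := by
  ext i j
  rw [walkMatrix, Matrix.of_apply, ofSimpleGraph_degree, h i, Matrix.smul_apply, smul_eq_mul,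
    div_eq_inv_mul]
  rfl

end WGraph

namespace WGraph

/-! Let `A` be the walk matrix. On the high eigenspace `A ^ k` can be inverted at cost `2 ^ k`
(`exists_pow_mulVec_eq`). By duality, a large level set `S` of `|v|` keeps `‖A ^ k 1_S‖` from being
small (`sq_level_mul_card_le`). If every dyadic level set at height `2 ^ j * τ` lost a factor `64`
of its squared norm in each of its first `j + 2` steps, it would be so small that `‖v‖₄⁴ < 2τ²`
(`sum_pow_four_lt`). With `τ² = 1 / (2δn)` this is false, so for some `S` and `t` the vector `x = A
^ t 1_S` has a slow next step and still has large norm (`exists_levelSet_slow_decay`). A slow step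
bounds `‖A x‖² = ⟨x, A² x⟩` from below. Negative eigenvalues may make `⟨x, A x⟩` tiny, but `x + A x`
has Rayleigh quotient bounded below (`rayleigh_add_mulVec`). Its 1-norm is only `2|S|`, so a local
Cheeger inequality (`exists_levelSet_of_rayleigh`) finds the small non-expanding level set. -/

theorem ind_nonneg {V : Type} [DecidableEq V] (S : Finset V) (i : V) : 0 ≤ ind S i := by
  unfold ind
  split_ifs <;> norm_num

/-! ### Symmetric doubly stochastic matrices -/

section DoublyStochastic

variable {V : Type} [Fintype V] {A : Matrix V V ℝ}

theorem dotProduct_mulVec_comm (hs : ∀ i j, A i j = A j i) (x y : V → ℝ) :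
    x ⬝ᵥ (A *ᵥ y) = (A *ᵥ x) ⬝ᵥ y := by
  have hT : Aᵀ = A := by
    ext i j
    exact hs j i
  rw [Matrix.dotProduct_mulVec, ← Matrix.mulVec_transpose, hT]

theorem mulVec_mono (h0 : ∀ i j, 0 ≤ A i j) {x y : V → ℝ} (hxy : ∀ i, x i ≤ y i) (i : V) :
    (A *ᵥ x) i ≤ (A *ᵥ y) i :=
  Finset.sum_le_sum fun j _ => mul_le_mul_of_nonneg_left (hxy j) (h0 i j)

theorem mulVec_nonneg (h0 : ∀ i j, 0 ≤ A i j) {x : V → ℝ} (hx : ∀ i, 0 ≤ x i) (i : V) :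
    0 ≤ (A *ᵥ x) i :=
  Finset.sum_nonneg fun j _ => mul_nonneg (h0 i j) (hx j)

theorem abs_mulVec_le (h0 : ∀ i j, 0 ≤ A i j) (x : V → ℝ) (i : V) :
    |(A *ᵥ x) i| ≤ (A *ᵥ fun j => |x j|) i := by
  refine (Finset.abs_sum_le_sum_abs _ _).trans (Finset.sum_le_sum fun j _ => ?_)
  rw [abs_mul, abs_of_nonneg (h0 i j)]

theorem dotProduct_nonneg_of_nonneg {x y : V → ℝ} (hx : ∀ i, 0 ≤ x i) (hy : ∀ i, 0 ≤ y i) :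
    0 ≤ x ⬝ᵥ y :=
  Finset.sum_nonneg fun i _ => mul_nonneg (hx i) (hy i)

theorem dotProduct_le_dotProduct {x y x' y' : V → ℝ} (hx : ∀ i, 0 ≤ x i) (hy : ∀ i, 0 ≤ y i)
    (hxx : ∀ i, x i ≤ x' i) (hyy : ∀ i, y i ≤ y' i) : x ⬝ᵥ y ≤ x' ⬝ᵥ y' :=
  Finset.sum_le_sum fun i _ => mul_le_mul (hxx i) (hyy i) (hy i) ((hx i).trans (hxx i))

theorem sum_mulVec (hs : ∀ i j, A i j = A j i) (h1 : ∀ i, ∑ j, A i j = 1) (x : V → ℝ) :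
    ∑ i, (A *ᵥ x) i = ∑ i, x i := by
  simp only [Matrix.mulVec, dotProduct]
  rw [Finset.sum_comm]
  refine Finset.sum_congr rfl fun j _ => ?_
  rw [← Finset.sum_mul, Finset.sum_congr rfl fun i _ => hs i j, h1, one_mul]

/-- A doubly stochastic symmetric matrix contracts the Euclidean norm. -/
theorem dotProduct_mulVec_self_le (hs : ∀ i j, A i j = A j i) (h0 : ∀ i j, 0 ≤ A i j)
    (h1 : ∀ i, ∑ j, A i j = 1) (x : V → ℝ) : (A *ᵥ x) ⬝ᵥ (A *ᵥ x) ≤ x ⬝ᵥ x := by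
  -- Each row of `A` is a probability vector, so this is Jensen for the square.
  have key : ∀ i, (A *ᵥ x) i * (A *ᵥ x) i ≤ (A *ᵥ fun j => x j * x j) i := by
    intro i
    have h := Finset.sum_mul_sq_le_sq_mul_sq Finset.univ (fun j => √(A i j))
      (fun j => √(A i j) * x j)
    have e1 : ∀ j, √(A i j) * (√(A i j) * x j) = A i j * x j := fun j => by
      rw [← mul_assoc, Real.mul_self_sqrt (h0 i j)]
    have e2 : ∀ j, √(A i j) ^ 2 = A i j := fun j => Real.sq_sqrt (h0 i j)
    simp only [mul_pow, e1, e2, h1, one_mul] at h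
    simp only [Matrix.mulVec, dotProduct]
    simpa [sq] using h
  calc (A *ᵥ x) ⬝ᵥ (A *ᵥ x) ≤ ∑ i, (A *ᵥ fun j => x j * x j) i :=
        Finset.sum_le_sum fun i _ => key i
    _ = x ⬝ᵥ x := sum_mulVec hs h1 _

/-! ### Ingredients of Cheeger's inequality -/

/-- A layer-cake principle: if a weighted sum of nonnegative reals is positive, then so is the
weighted count of those that reach some threshold. -/
theorem exists_threshold_of_sum_pos {ι : Type*} [Fintype ι] (w a : ι → ℝ) (ha : ∀ k, 0 ≤ a k)
    (h : 0 < ∑ k, w k * a k) : ∃ s : ℝ, 0 < s ∧ 0 < ∑ k, w k * (if s ≤ a k then 1 else 0) := by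
  by_contra! hcon
  obtain ⟨M, hM⟩ : ∃ M, ∀ k, a k ≤ M := by
    obtain ⟨M, hM⟩ := (Set.finite_range a).bddAbove
    exact ⟨M, fun k => hM ⟨k, rfl⟩⟩
  have hite : ∀ k, (fun s : ℝ => if s ≤ a k then (1 : ℝ) else 0) =
      (Set.Iic (a k)).indicator fun _ => 1 := by
    intro k
    ext s
    simp [Set.indicator_apply]
  have hint : ∀ k, MeasureTheory.IntegrableOn (fun s : ℝ => if s ≤ a k then (1 : ℝ) else 0)
      (Set.Ioc 0 M) := by
    intro k
    rw [hite]
    refine MeasureTheory.Integrable.indicator ?_ measurableSet_Iic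
    exact MeasureTheory.integrableOn_const (by simp)
  have hval : ∀ k, ∫ s in Set.Ioc 0 M, (if s ≤ a k then (1 : ℝ) else 0) = a k := by
    intro k
    have hI : Set.Ioc 0 M ∩ Set.Iic (a k) = Set.Ioc 0 (a k) := by
      ext s
      simp only [Set.mem_inter_iff, Set.mem_Ioc, Set.mem_Iic]
      exact ⟨fun hs => ⟨hs.1.1, hs.2⟩, fun hs => ⟨⟨hs.1, hs.2.trans (hM k)⟩, hs.2⟩⟩
    rw [hite, MeasureTheory.setIntegral_indicator measurableSet_Iic, hI]
    simp [ha k]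
  have htot : ∫ s in Set.Ioc 0 M, ∑ k, w k * (if s ≤ a k then (1 : ℝ) else 0) =
      ∑ k, w k * a k := by
    rw [MeasureTheory.integral_finsetSum _ fun k _ => (hint k).const_mul (w k)]
    refine Finset.sum_congr rfl fun k _ => ?_
    rw [MeasureTheory.integral_const_mul, hval]
  have hle := MeasureTheory.setIntegral_nonpos (μ := MeasureTheory.volume)
    (measurableSet_Ioc (a := (0 : ℝ)) (b := M)) fun s hs => hcon s hs.1
  linarith

/-- The Cauchy–Schwarz step of Cheeger's inequality. -/
theorem sum_min_sq_ge (hs : ∀ i j, A i j = A j i) (h0 : ∀ i j, 0 ≤ A i j)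
    (h1 : ∀ i, ∑ j, A i j = 1) {h : V → ℝ} {r : ℝ} (hr : 0 ≤ r)
    (hR : r * (h ⬝ᵥ h) ≤ h ⬝ᵥ (A *ᵥ h)) :
    r ^ 2 / 2 * ∑ i, h i ^ 2 ≤ ∑ i, ∑ j, A i j * min (h i ^ 2) (h j ^ 2) := by
  -- AM-GM with weight `r / 2`: the error term sums to `r ^ 2 / 2 * ∑ h i ^ 2`, half of what `hR`
  -- provides.
  have hpt : ∀ i j, r * (A i j * (h i * h j)) ≤
      A i j * min (h i ^ 2) (h j ^ 2) + r ^ 2 / 4 * (A i j * (h i ^ 2 + h j ^ 2)) := by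
    intro i j
    have key : r * (h i * h j) ≤
        min (h i ^ 2) (h j ^ 2) + r ^ 2 / 4 * (h i ^ 2 + h j ^ 2) := by
      rcases le_total (h i ^ 2) (h j ^ 2) with hl | hl
      · rw [min_eq_left hl]
        linarith [sq_nonneg (h i - r / 2 * h j), sq_nonneg (r / 2 * h i)]
      · rw [min_eq_right hl]
        linarith [sq_nonneg (h j - r / 2 * h i), sq_nonneg (r / 2 * h j)]
    have := mul_le_mul_of_nonneg_left key (h0 i j)
    linarith
  have hsum := Finset.sum_le_sum fun i (_ : i ∈ Finset.univ) =>
    Finset.sum_le_sum fun j (_ : j ∈ Finset.univ) => hpt i j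
  have e1 : ∑ i, ∑ j, r * (A i j * (h i * h j)) = r * (h ⬝ᵥ (A *ᵥ h)) := by
    simp only [dotProduct, Matrix.mulVec, Finset.mul_sum]
    exact Finset.sum_congr rfl fun i _ => Finset.sum_congr rfl fun j _ => by ring
  have e2 : ∑ i, ∑ j, A i j * (h i ^ 2 + h j ^ 2) = 2 * ∑ i, h i ^ 2 := by
    have ea : ∑ i, ∑ j, A i j * h i ^ 2 = ∑ i, h i ^ 2 :=
      Finset.sum_congr rfl fun i _ => by rw [← Finset.sum_mul, h1, one_mul]
    have eb : ∑ i, ∑ j, A i j * h j ^ 2 = ∑ i, h i ^ 2 := sum_mulVec hs h1 fun j => h j ^ 2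
    simp only [mul_add, Finset.sum_add_distrib, ea, eb]
    ring
  have e3 : h ⬝ᵥ h = ∑ i, h i ^ 2 := Finset.sum_congr rfl fun i _ => (sq (h i)).symm
  simp only [Finset.sum_add_distrib, ← Finset.mul_sum, e2] at hsum
  simp only [Finset.mul_sum] at hsum
  rw [e1] at hsum
  rw [e3] at hR
  have := mul_le_mul_of_nonneg_left hR hr
  simp only [← Finset.mul_sum] at hsum this ⊢
  linarith

/-- For nonnegative `x`, the vector `x + A x` has Rayleigh quotient at least `1 / 128` if `A` shrinks
the norm of `x` by at most a factor `8`. -/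
theorem rayleigh_add_mulVec (hs : ∀ i j, A i j = A j i) (h0 : ∀ i j, 0 ≤ A i j)
    (h1 : ∀ i, ∑ j, A i j = 1) {x : V → ℝ} (hx : ∀ i, 0 ≤ x i)
    (hstep : x ⬝ᵥ x ≤ 64 * ((A *ᵥ x) ⬝ᵥ (A *ᵥ x))) :
    1 / 128 * ((x + A *ᵥ x) ⬝ᵥ (x + A *ᵥ x)) ≤ (x + A *ᵥ x) ⬝ᵥ (A *ᵥ (x + A *ᵥ x)) := by
  have hy := mulVec_nonneg h0 hx
  have p1 := dotProduct_nonneg_of_nonneg hx hy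
  have p2 := dotProduct_nonneg_of_nonneg hy (mulVec_nonneg h0 hy)
  have hc : x ⬝ᵥ (A *ᵥ (A *ᵥ x)) = (A *ᵥ x) ⬝ᵥ (A *ᵥ x) := dotProduct_mulVec_comm hs _ _
  have hle := dotProduct_mulVec_self_le hs h0 h1 x
  have hd : 0 ≤ (x - A *ᵥ x) ⬝ᵥ (x - A *ᵥ x) :=
    Finset.sum_nonneg fun i _ => mul_self_nonneg _
  have hcomm : (A *ᵥ x) ⬝ᵥ x = x ⬝ᵥ (A *ᵥ x) := dotProduct_comm _ _
  simp only [Matrix.mulVec_add, dotProduct_add, add_dotProduct, sub_dotProduct, dotProduct_sub,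
    hc, hcomm] at hd ⊢
  linarith

variable [DecidableEq V]

/-! ### Matrix powers and indicator vectors -/

theorem pow_entry_symm (hs : ∀ i j, A i j = A j i) (k : ℕ) (i j : V) :
    (A ^ k) i j = (A ^ k) j i := by
  have hT : Aᵀ = A := by
    ext i j
    exact hs j i
  rw [← Matrix.transpose_apply (A ^ k) i j, Matrix.transpose_pow, hT]

theorem pow_entry_nonneg (h0 : ∀ i j, 0 ≤ A i j) (k : ℕ) (i j : V) : 0 ≤ (A ^ k) i j := by
  induction k generalizing i j with
  | zero =>
    rw [pow_zero, Matrix.one_apply]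
    split_ifs <;> norm_num
  | succ k ih =>
    rw [pow_succ, Matrix.mul_apply]
    exact Finset.sum_nonneg fun l _ => mul_nonneg (ih i l) (h0 l j)

theorem pow_row_sum (h1 : ∀ i, ∑ j, A i j = 1) (k : ℕ) (i : V) : ∑ j, (A ^ k) i j = 1 := by
  have h : ∀ k : ℕ, (A ^ k) *ᵥ (fun _ => 1) = fun _ => 1 := by
    intro k
    induction k with
    | zero => simp
    | succ k ih =>
      have hA : A *ᵥ (fun _ => (1 : ℝ)) = fun _ => 1 := by
        ext i
        simpa [Matrix.mulVec, dotProduct] using h1 i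
      rw [pow_succ, ← Matrix.mulVec_mulVec, hA, ih]
  simpa [Matrix.mulVec, dotProduct] using congrFun (h k) i

theorem sum_ind (S : Finset V) : ∑ i, ind S i = (S.card : ℝ) := by
  simp [ind]

theorem ind_dotProduct_self (S : Finset V) : ind S ⬝ᵥ ind S = (S.card : ℝ) := by
  simp [ind, dotProduct]

theorem ind_dotProduct_mulVec_ind (S : Finset V) :
    ind S ⬝ᵥ (A *ᵥ ind S) = ∑ i, ∑ j, A i j * (if i ∈ S ∧ j ∈ S then 1 else 0) := by
  simp only [dotProduct, Matrix.mulVec, ind, Finset.mul_sum]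
  refine Finset.sum_congr rfl fun i _ => Finset.sum_congr rfl fun j _ => ?_
  by_cases hi : i ∈ S <;> by_cases hj : j ∈ S <;> simp [hi, hj]

/-! ### Local Cheeger inequality -/

/-- If the sum of `A i j * min (a i) (a j)` exceeds `c * ∑ a i`, then some threshold set of `a`
retains more than a `c` fraction of its mass under `A`. -/
theorem exists_threshold_of_sum_min {a : V → ℝ} (ha : ∀ i, 0 ≤ a i) {c : ℝ}
    (hmin : c * ∑ i, a i < ∑ i, ∑ j, A i j * min (a i) (a j)) :
    ∃ s : ℝ, 0 < s ∧ ∀ T : Finset V, (∀ i, i ∈ T ↔ s ≤ a i) →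
      c * (T.card : ℝ) < ind T ⬝ᵥ (A *ᵥ ind T) := by
  -- Pairs carry weight `A i j` and vertices weight `-c`, so one threshold serves both sums; `min`
  -- reaches `s` exactly when both endpoints do.
  obtain ⟨s, hs, h⟩ := exists_threshold_of_sum_pos (ι := (V × V) ⊕ V)
    (Sum.elim (fun p => A p.1 p.2) fun _ => -c)
    (Sum.elim (fun p => min (a p.1) (a p.2)) a)
    (by rintro (p | i); exacts [le_min (ha _) (ha _), ha _])
    (by
      simp only [Fintype.sum_sum_type, Sum.elim_inl, Sum.elim_inr, Fintype.sum_prod_type,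
        ← Finset.mul_sum]
      linarith)
  refine ⟨s, hs, fun T hT => ?_⟩
  simp only [Fintype.sum_sum_type, Sum.elim_inl, Sum.elim_inr, Fintype.sum_prod_type,
    ← Finset.mul_sum, le_min_iff, ← hT] at h
  rw [ind_dotProduct_mulVec_ind, ← sum_ind]
  unfold ind
  linarith

/-- A local form of Cheeger's inequality: a nonnegative vector whose Rayleigh quotient is at
least `ρ` has a level set that is small if the vector has small `1`-norm, and whose expansion
is bounded away from `1`. -/
theorem exists_levelSet_of_rayleigh (hs : ∀ i j, A i j = A j i) (h0 : ∀ i j, 0 ≤ A i j)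
    (h1 : ∀ i, ∑ j, A i j = 1) {f : V → ℝ} (hf : ∀ i, 0 ≤ f i) (hpos : 0 < f ⬝ᵥ f) {ρ : ℝ}
    (hρ : 0 < ρ) (hR : ρ * (f ⬝ᵥ f) ≤ f ⬝ᵥ (A *ᵥ f)) :
    ∃ τ : ℝ, 0 < τ ∧ ∀ T : Finset V, (∀ i, i ∈ T ↔ τ ≤ f i) →
      (T.card : ℝ) * (ρ * (f ⬝ᵥ f)) ≤ 4 * (∑ i, f i) ^ 2 ∧
      ρ ^ 2 / 16 * (T.card : ℝ) < ind T ⬝ᵥ (A *ᵥ ind T) := by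
  have hsum : 0 < ∑ i, f i := by
    refine (Finset.sum_nonneg fun i _ => hf i).lt_of_ne fun h => hpos.ne ?_
    have hz := (Finset.sum_eq_zero_iff_of_nonneg fun i _ => hf i).1 h.symm
    exact (Finset.sum_eq_zero fun i hi => by rw [hz i hi, zero_mul]).symm
  -- Cutting `f` below `θ` costs at most `2 * θ * ∑ f i`, half of the assumed bound on the quadratic
  -- form, and leaves at most `(∑ f i) / θ` vertices.
  set θ : ℝ := ρ / 4 * (f ⬝ᵥ f) / ∑ i, f i with hθ
  have hθpos : 0 < θ := by positivity
  have hθs : θ * ∑ i, f i = ρ / 4 * (f ⬝ᵥ f) := by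
    rw [hθ]
    field_simp
  set h : V → ℝ := fun i => if θ ≤ f i then f i else 0 with hh
  have hh0 : ∀ i, 0 ≤ h i := fun i => by
    simp only [hh]
    split_ifs
    exacts [hf i, le_rfl]
  have hhf : ∀ i, h i ≤ f i := fun i => by
    simp only [hh]
    split_ifs
    exacts [le_rfl, hf i]
  have hfh : ∀ i, f i - h i ≤ θ := fun i => by
    simp only [hh]
    split_ifs with hi
    · simpa using hθpos.le
    · simpa using (not_le.1 hi).le
  have hdrop : (f - h) ⬝ᵥ (A *ᵥ f) ≤ θ * ∑ i, f i := by
    rw [← sum_mulVec hs h1 f, Finset.mul_sum]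
    exact Finset.sum_le_sum fun i _ =>
      mul_le_mul_of_nonneg_right (hfh i) (mulVec_nonneg h0 hf i)
  have hdrop' : (f - h) ⬝ᵥ (A *ᵥ h) ≤ (f - h) ⬝ᵥ (A *ᵥ f) :=
    dotProduct_le_dotProduct (fun i => sub_nonneg.2 (hhf i)) (mulVec_nonneg h0 hh0)
      (fun _ => le_rfl) (mulVec_mono h0 hhf)
  have hsplit : f ⬝ᵥ (A *ᵥ f) =
      h ⬝ᵥ (A *ᵥ h) + (f - h) ⬝ᵥ (A *ᵥ h) + (f - h) ⬝ᵥ (A *ᵥ f) := by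
    have hc : h ⬝ᵥ (A *ᵥ f) = f ⬝ᵥ (A *ᵥ h) := by
      rw [dotProduct_mulVec_comm hs, dotProduct_comm]
    simp only [sub_dotProduct, hc]
    ring
  have hRh : ρ / 2 * (f ⬝ᵥ f) ≤ h ⬝ᵥ (A *ᵥ h) := by linarith
  have hle : h ⬝ᵥ h ≤ f ⬝ᵥ f := dotProduct_le_dotProduct hh0 hh0 hhf hhf
  have hhpos : 0 < h ⬝ᵥ h := by
    refine (dotProduct_nonneg_of_nonneg hh0 hh0).lt_of_ne fun hz => ?_
    have hz' : h = 0 := dotProduct_self_eq_zero.1 hz.symm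
    rw [hz', zero_dotProduct] at hRh
    have : 0 < ρ / 2 * (f ⬝ᵥ f) := by positivity
    linarith
  have hmin := sum_min_sq_ge hs h0 h1 (h := h) (r := ρ / 2) (by positivity)
    ((mul_le_mul_of_nonneg_left hle (by positivity)).trans hRh)
  have hsq : 0 < ∑ i, h i ^ 2 := by simpa [dotProduct, sq] using hhpos
  -- `sum_min_sq_ge` with `r = ρ / 2` gives `ρ ^ 2 / 8`; halving it makes the inequality strict,
  -- which later forces `T` to be nonempty.
  obtain ⟨s, hs0, hT⟩ := exists_threshold_of_sum_min (A := A) (a := fun i => h i ^ 2)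
    (fun i => sq_nonneg (h i)) (c := ρ ^ 2 / 16) (by
      refine lt_of_lt_of_le (mul_lt_mul_of_pos_right ?_ hsq) hmin
      nlinarith [sq_pos_of_pos hρ])
  have hiff : ∀ i, max θ (√s) ≤ f i ↔ s ≤ h i ^ 2 := by
    intro i
    rw [← Real.sqrt_le_left (hh0 i), max_le_iff]
    simp only [hh]
    by_cases hi : θ ≤ f i
    · simp [hi]
    · simp [hi, Real.sqrt_pos.2 hs0]
  refine ⟨max θ (√s), lt_max_of_lt_left hθpos, fun T hTf => ⟨?_, ?_⟩⟩
  · have hcard : (T.card : ℝ) * θ ≤ ∑ i, f i := by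
      calc (T.card : ℝ) * θ = ∑ i ∈ T, θ := by simp
        _ ≤ ∑ i ∈ T, f i := Finset.sum_le_sum fun i hi =>
            (le_max_left _ _).trans ((hTf i).1 hi)
        _ ≤ ∑ i, f i :=
            Finset.sum_le_sum_of_subset_of_nonneg (Finset.subset_univ _) fun i _ _ => hf i
    have := mul_le_mul_of_nonneg_right hcard hsum.le
    rw [mul_assoc, hθs] at this
    linarith
  · exact hT T fun i => (hTf i).trans (hiff i)

/-- If `v = A ^ k u`, then the mass that `|v|` puts on `S` bounds `A ^ k 1_S` from below. -/
theorem sq_level_mul_card_le (hs : ∀ i j, A i j = A j i) (h0 : ∀ i j, 0 ≤ A i j) {k : ℕ}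
    {u v : V → ℝ} (hu : (A ^ k) *ᵥ u = v) {τ : ℝ} (hτ : 0 ≤ τ) {S : Finset V}
    (hS : ∀ i ∈ S, τ ≤ |v i|) :
    (τ * (S.card : ℝ)) ^ 2 ≤ ((A ^ k) *ᵥ ind S) ⬝ᵥ ((A ^ k) *ᵥ ind S) * (u ⬝ᵥ u) := by
  -- Move `A ^ k` across the pairing, using `|v| ≤ A ^ k |u|`; Cauchy–Schwarz then finishes.
  have h : τ * (S.card : ℝ) ≤ ((A ^ k) *ᵥ ind S) ⬝ᵥ fun i => |u i| := by
    rw [← dotProduct_mulVec_comm (pow_entry_symm hs k), ← sum_ind, Finset.mul_sum]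
    refine Finset.sum_le_sum fun i _ => ?_
    by_cases hi : i ∈ S
    · simp only [ind, hi, if_true, mul_one, one_mul]
      refine (hS i hi).trans ?_
      rw [← hu]
      exact abs_mulVec_le (pow_entry_nonneg h0 k) u i
    · simp [ind, hi]
  refine (pow_le_pow_left₀ (by positivity) h 2).trans ?_
  have hcs := Finset.sum_mul_sq_le_sq_mul_sq Finset.univ ((A ^ k) *ᵥ ind S) fun i => |u i|
  simpa only [dotProduct, sq_abs, sq, abs_mul_abs_self] using hcs

end DoublyStochastic

/-! ### Inverting the walk on the high eigenspace -/

section HighEigenspan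

variable {V : Type} [Fintype V]

theorem walkMatrix_properties {G : WGraph V} (hG : G.IsRegular) :
    (∀ i j, G.walkMatrix i j = G.walkMatrix j i) ∧ (∀ i j, 0 ≤ G.walkMatrix i j) ∧
      ∀ i, ∑ j, G.walkMatrix i j = 1 := by
  obtain ⟨d, hd, hdeg⟩ := hG
  refine ⟨fun i j => ?_, fun i j => ?_, fun i => ?_⟩
  · simp only [walkMatrix, Matrix.of_apply, hdeg, G.weight_symm i j]
  · simp only [walkMatrix, Matrix.of_apply, hdeg]
    exact div_nonneg (G.weight_nonneg i j) hd.le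
  · simp only [walkMatrix, Matrix.of_apply, ← Finset.sum_div]
    rw [← degree, hdeg, div_self hd.ne']

variable [DecidableEq V]

/-- On the span of the eigenvectors with eigenvalue at least `1 / 2`, the `k`-th power of the walk
matrix has a right inverse of norm at most `2 ^ k`. -/
theorem exists_pow_mulVec_eq {G : WGraph V} (hs : ∀ i j, G.walkMatrix i j = G.walkMatrix j i)
    {v : V → ℝ} (hv : v ∈ G.highEigenspan (1 / 2)) (k : ℕ) :
    ∃ u : V → ℝ, (G.walkMatrix ^ k) *ᵥ u = v ∧ u ⬝ᵥ u ≤ 4 ^ k * (v ⬝ᵥ v) := by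
  set A := G.walkMatrix with hA
  have hH : A.IsHermitian := by
    ext i j
    simpa using hs j i
  set b := hH.eigenvectorBasis with hb
  set μ := hH.eigenvalues with hμ
  have hAb : ∀ i, A *ᵥ (b i).ofLp = μ i • (b i).ofLp := fun i => hH.mulVec_eigenvectorBasis i
  -- Eigenvectors of a symmetric matrix with different eigenvalues are orthogonal.
  have hcoef : ∀ i, μ i < 1 / 2 → (b i).ofLp ⬝ᵥ v = 0 := by
    intro i hi
    refine Submodule.span_induction (p := fun x _ => (b i).ofLp ⬝ᵥ x = 0) ?_ ?_ ?_ ?_ hv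
    · rintro x ⟨ν, hν, hx⟩
      have hAx : A *ᵥ x = ν • x := by simpa using hx.apply_eq_smul
      have h := dotProduct_mulVec_comm hs (b i).ofLp x
      rw [hAx, hAb, dotProduct_smul, smul_dotProduct, smul_eq_mul, smul_eq_mul] at h
      have h' : (ν - μ i) * ((b i).ofLp ⬝ᵥ x) = 0 := by linarith
      exact (mul_eq_zero.1 h').resolve_left (by linarith)
    · simp
    · intro x y _ _ hx hy
      rw [dotProduct_add, hx, hy, add_zero]
    · intro a x _ hx
      rw [dotProduct_smul, hx, smul_zero]
  have hpow : ∀ i, (A ^ k) *ᵥ (b i).ofLp = μ i ^ k • (b i).ofLp := by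
    intro i
    induction k with
    | zero => simp
    | succ k ih =>
      rw [pow_succ, ← Matrix.mulVec_mulVec, hAb, Matrix.mulVec_smul, ih, smul_smul, pow_succ,
        mul_comm]
  have hsq : ∀ c : V → ℝ, (∑ i, c i • (b i).ofLp) ⬝ᵥ (∑ i, c i • (b i).ofLp) = ∑ i, c i ^ 2 := by
    intro c
    have hn := b.repr.symm.norm_map (WithLp.toLp 2 c)
    rw [← b.sum_repr_symm] at hn
    have hn2 := congrArg (· ^ 2) hn
    simp only [EuclideanSpace.real_norm_sq_eq] at hn2
    simpa [dotProduct, sq] using hn2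
  have hexp : v = ∑ i, ((b i).ofLp ⬝ᵥ v) • (b i).ofLp := by
    have h := congrArg WithLp.ofLp (b.sum_repr' (WithLp.toLp 2 v))
    simp only [EuclideanSpace.inner_eq_star_dotProduct] at h
    simpa [dotProduct_comm] using h.symm
  -- Divide each coefficient by `μ i ^ k`; where `μ i < 1 / 2`, possibly zero, the coefficient of
  -- `v` vanishes.
  refine ⟨∑ i, ((μ i ^ k)⁻¹ * ((b i).ofLp ⬝ᵥ v)) • (b i).ofLp, ?_, ?_⟩
  · rw [Matrix.mulVec_sum]
    conv_rhs => rw [hexp]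
    refine Finset.sum_congr rfl fun i _ => ?_
    rw [Matrix.mulVec_smul, hpow, smul_smul]
    rcases lt_or_ge (μ i) (1 / 2) with hi | hi
    · rw [hcoef i hi]
      simp
    · have : μ i ^ k ≠ 0 := pow_ne_zero _ (by linarith)
      congr 1
      field_simp
  · have hvv : v ⬝ᵥ v = ∑ i, ((b i).ofLp ⬝ᵥ v) ^ 2 := by
      conv_lhs => rw [hexp]
      exact hsq _
    rw [hsq, hvv, Finset.mul_sum]
    refine Finset.sum_le_sum fun i _ => ?_
    rcases lt_or_ge (μ i) (1 / 2) with hi | hi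
    · rw [hcoef i hi]
      simp
    · rw [mul_pow]
      refine mul_le_mul_of_nonneg_right ?_ (sq_nonneg _)
      have h2 : (μ i)⁻¹ ≤ 2 := by
        rw [inv_le_comm₀ (by linarith) two_pos]
        linarith
      have h3 : 0 ≤ (μ i)⁻¹ := inv_nonneg.2 (by linarith)
      calc ((μ i ^ k)⁻¹) ^ 2 = (((μ i)⁻¹) ^ 2) ^ k := by
            rw [← inv_pow, ← pow_mul, ← pow_mul, mul_comm]
        _ ≤ 4 ^ k := pow_le_pow_left₀ (sq_nonneg _) (by nlinarith) k

end HighEigenspan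

/-! ### Dyadic bound on the fourth moment -/

/-- Dyadic decomposition of the fourth power above the scale `τ`. -/
theorem pow_four_le_dyadic {τ x : ℝ} (hτ : 0 < τ) (hx : 0 ≤ x) (J : ℕ) (hJ : x < 2 ^ J * τ) :
    x ^ 4 ≤ τ ^ 2 * x ^ 2 +
      ∑ j ∈ Finset.range J, 16 * (2 ^ j * τ) ^ 4 * (if 2 ^ j * τ ≤ x then 1 else 0) := by
  induction J with
  | zero =>
    simp only [pow_zero, one_mul] at hJ
    have : x ^ 2 ≤ τ ^ 2 := pow_le_pow_left₀ hx hJ.le 2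
    simp only [Finset.range_zero, Finset.sum_empty, add_zero]
    nlinarith [sq_nonneg x]
  | succ J ih =>
    rw [Finset.sum_range_succ]
    rcases lt_or_ge x (2 ^ J * τ) with h | h
    · have : (0 : ℝ) ≤ 16 * (2 ^ J * τ) ^ 4 * (if 2 ^ J * τ ≤ x then 1 else 0) := by
        split_ifs <;> positivity
      linarith [ih h]
    · have hnn : (0 : ℝ) ≤
          ∑ j ∈ Finset.range J, 16 * (2 ^ j * τ) ^ 4 * (if 2 ^ j * τ ≤ x then 1 else 0) :=
        Finset.sum_nonneg fun j _ => by split_ifs <;> positivity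
      -- The top scale reached is within a factor `2` of `x`, hence the constant `16 = 2 ^ 4`.
      have h4 : x ^ 4 ≤ (2 * (2 ^ J * τ)) ^ 4 :=
        pow_le_pow_left₀ hx (by rw [pow_succ] at hJ; linarith) 4
      have hp : 0 ≤ τ ^ 2 * x ^ 2 := by positivity
      rw [if_pos h]
      linarith

/-- If all dyadic level sets above the scale `τ` are small, so is the sum of fourth powers. -/
theorem sum_pow_four_lt {V : Type} [Fintype V] {w : V → ℝ} (hw : ∀ i, 0 ≤ w i)
    (h2 : ∑ i, w i ^ 2 = 1) {τ : ℝ} (hτ : 0 < τ)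
    (hcard : ∀ j : ℕ, (2 ^ j * τ) ^ 2 *
      ((Finset.univ.filter fun i => 2 ^ j * τ ≤ w i).card : ℝ) ≤ (1 / 16) ^ (j + 2)) :
    ∑ i, w i ^ 4 < 2 * τ ^ 2 := by
  obtain ⟨J, hJ⟩ : ∃ J : ℕ, ∀ i, w i < 2 ^ J * τ := by
    obtain ⟨M, hM⟩ := (Set.finite_range w).bddAbove
    obtain ⟨J, hJ⟩ := pow_unbounded_of_one_lt (M / τ) (one_lt_two (α := ℝ))
    exact ⟨J, fun i => (hM ⟨i, rfl⟩).trans_lt ((div_lt_iff₀ hτ).1 hJ)⟩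
  have hterm : ∀ j : ℕ, 16 * (2 ^ j * τ) ^ 4 *
      ((Finset.univ.filter fun i => 2 ^ j * τ ≤ w i).card : ℝ) ≤ τ ^ 2 / 16 * (1 / 4) ^ j := by
    intro j
    have h := mul_le_mul_of_nonneg_left (hcard j)
      (show 0 ≤ 16 * (2 ^ j * τ) ^ 2 by positivity)
    have e : 16 * (2 ^ j * τ) ^ 2 * (1 / 16) ^ (j + 2) = τ ^ 2 / 16 * (1 / 4 : ℝ) ^ j := by
      have h4 : ((2 : ℝ) ^ j) ^ 2 * (1 / 16) ^ j = (1 / 4) ^ j := by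
        rw [← pow_mul, mul_comm j 2, pow_mul, ← mul_pow]
        norm_num
      rw [pow_add, mul_pow, ← h4]
      ring
    rw [← e]
    refine le_of_eq_of_le ?_ h
    ring
  have hgeo : ∑ j ∈ Finset.range J, (1 / 4 : ℝ) ^ j ≤ 2 := by
    rw [geom_sum_eq (by norm_num)]
    have : (0 : ℝ) ≤ (1 / 4) ^ J := by positivity
    rw [div_le_iff_of_neg (by norm_num)]
    linarith
  calc ∑ i, w i ^ 4 ≤ ∑ i, (τ ^ 2 * w i ^ 2 + ∑ j ∈ Finset.range J,
        16 * (2 ^ j * τ) ^ 4 * (if 2 ^ j * τ ≤ w i then 1 else 0)) :=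
        Finset.sum_le_sum fun i _ => pow_four_le_dyadic hτ (hw i) J (hJ i)
    _ = τ ^ 2 + ∑ j ∈ Finset.range J, 16 * (2 ^ j * τ) ^ 4 *
          ((Finset.univ.filter fun i => 2 ^ j * τ ≤ w i).card : ℝ) := by
        rw [Finset.sum_add_distrib, ← Finset.mul_sum, h2, mul_one, Finset.sum_comm]
        simp only [← Finset.mul_sum, Finset.sum_boole]
    _ ≤ τ ^ 2 + ∑ j ∈ Finset.range J, τ ^ 2 / 16 * (1 / 4) ^ j := by
        exact add_le_add_right (Finset.sum_le_sum fun j _ => hterm j) _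
    _ ≤ τ ^ 2 + τ ^ 2 / 16 * 2 := by
        rw [← Finset.mul_sum]
        gcongr
    _ < 2 * τ ^ 2 := by nlinarith [sq_pos_of_pos hτ]

/-! ### A level set with a slow step -/

/-- A dyadic level set `S` of `|v|` and a time `t` at which the walk from `S` has not spread out
and is contracted by a bounded factor only. -/
theorem exists_levelSet_slow_decay {V : Type} [Fintype V] [DecidableEq V] {G : WGraph V}
    (hG : G.IsRegular) {v : V → ℝ} (hv : v ∈ G.highEigenspan (1 / 2)) (h2 : ∑ i, v i ^ 2 = 1)
    {τ : ℝ} (hτ : 0 < τ) (h4 : 2 * τ ^ 2 ≤ ∑ i, |v i| ^ 4) :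
    ∃ (S : Finset V) (j t : ℕ), S.Nonempty ∧ (∀ i, i ∈ S ↔ 2 ^ j * τ ≤ |v i|) ∧ t ≤ j + 1 ∧
      τ ^ 2 * (S.card : ℝ) ^ 2 ≤
        16 * (((G.walkMatrix ^ t) *ᵥ ind S) ⬝ᵥ ((G.walkMatrix ^ t) *ᵥ ind S)) ∧
      ((G.walkMatrix ^ t) *ᵥ ind S) ⬝ᵥ ((G.walkMatrix ^ t) *ᵥ ind S) ≤
        64 * ((G.walkMatrix *ᵥ ((G.walkMatrix ^ t) *ᵥ ind S)) ⬝ᵥ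
          (G.walkMatrix *ᵥ ((G.walkMatrix ^ t) *ᵥ ind S))) := by
  obtain ⟨hs, h0, h1⟩ := walkMatrix_properties hG
  set A := G.walkMatrix with hA
  set a : Finset V → ℕ → ℝ := fun S t => ((A ^ t) *ᵥ ind S) ⬝ᵥ ((A ^ t) *ᵥ ind S) with ha
  have hsucc : ∀ S t, (A *ᵥ ((A ^ t) *ᵥ ind S)) ⬝ᵥ (A *ᵥ ((A ^ t) *ᵥ ind S)) = a S (t + 1) := by
    intro S t
    rw [Matrix.mulVec_mulVec, ← pow_succ']
  have hvv : v ⬝ᵥ v = 1 := by rw [← h2]; exact Finset.sum_congr rfl fun i _ => (sq (v i)).symm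
  have hanti : ∀ S, Antitone (a S) := fun S => antitone_nat_of_succ_le fun t => by
    rw [← hsucc]
    exact dotProduct_mulVec_self_le hs h0 h1 _
  have hlow : ∀ (S : Finset V) (j : ℕ), (∀ i ∈ S, 2 ^ j * τ ≤ |v i|) →
      (2 ^ j * τ * (S.card : ℝ)) ^ 2 ≤ a S (j + 2) * 4 ^ (j + 2) := by
    intro S j hS
    obtain ⟨u, hu, hun⟩ := exists_pow_mulVec_eq hs hv (j + 2)
    rw [hvv, mul_one] at hun
    refine (sq_level_mul_card_le hs h0 hu (by positivity) hS).trans ?_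
    exact mul_le_mul_of_nonneg_left hun (Finset.sum_nonneg fun i _ => mul_self_nonneg _)
  have h4j : ∀ j : ℕ, (4 : ℝ) ^ (j + 2) = 16 * (2 ^ j) ^ 2 := by
    intro j
    rw [pow_add, ← pow_mul, mul_comm j 2, pow_mul]
    norm_num
    ring
  -- Fast decay at every dyadic scale will verify the cardinality hypothesis of `sum_pow_four_lt`.
  by_contra! hcon
  refine (sum_pow_four_lt (fun i => abs_nonneg (v i)) (by simpa using h2) hτ fun j => ?_).not_ge h4
  set S := Finset.univ.filter fun i => 2 ^ j * τ ≤ |v i| with hSdef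
  have hS : ∀ i, i ∈ S ↔ 2 ^ j * τ ≤ |v i| := by simp [hSdef]
  have hl := hlow S j fun i hi => (hS i).1 hi
  rcases S.eq_empty_or_nonempty with he | hne
  · rw [he]
    simp only [Finset.card_empty, Nat.cast_zero, mul_zero]
    positivity
  have hcpos : (0 : ℝ) < S.card := by exact_mod_cast hne.card_pos
  have hdec : ∀ t ≤ j + 2, a S t ≤ (1 / 64) ^ t * (S.card : ℝ) := by
    intro t
    induction t with
    | zero =>
      intro _
      simp [ha, ind_dotProduct_self]
    | succ t ih =>
      intro ht
      -- The norm is antitone in time, so the lower bound at time `j + 2` holds at `t`; `4 ^ (j +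
      -- 2)` cancels `(2 ^ j) ^ 2` up to `16`.
      have hbig : τ ^ 2 * (S.card : ℝ) ^ 2 ≤ 16 * a S t := by
        have hm := hanti S (show t ≤ j + 2 by omega)
        rw [h4j] at hl
        have hp : (0 : ℝ) < (2 ^ j) ^ 2 := by positivity
        refine le_of_mul_le_mul_left ?_ hp
        nlinarith
      have h := hcon S j t hne hS (by omega) hbig
      rw [hsucc] at h
      have := ih (by omega)
      rw [pow_succ]
      linarith
  have hd := hdec (j + 2) le_rfl
  -- Decay `1 / 64` per step against inversion cost `4` leaves `1 / 16`, which beats the dyadic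
  -- growth of the heights.
  have h16 : ((1 : ℝ) / 64) ^ (j + 2) * 4 ^ (j + 2) = (1 / 16) ^ (j + 2) := by
    rw [← mul_pow]
    norm_num
  refine le_of_mul_le_mul_right ?_ hcpos
  have := mul_le_mul_of_nonneg_right hd (show (0 : ℝ) ≤ 4 ^ (j + 2) by positivity)
  rw [← h16]
  nlinarith

end WGraph

/-! ### Assembly and constants -/

theorem mainTheorem4 :
    ∃ c C : ℝ, 0 < c ∧ 0 < C ∧
      ∀ (n : ℕ) (G : WGraph (Fin n)), G.IsRegular →
      ∀ δ : ℝ, 0 < δ → δ ≤ 1 / 2 →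
      ∀ v : Fin n → ℝ, v ∈ G.highEigenspan (1 / 2) →
        ∑ i, v i ^ 2 = 1 →
        1 / (δ * n) ≤ ∑ i, |v i| ^ 4 →
        ∃ S : Finset (Fin n), S.Nonempty ∧ WGraph.IsLevelSet (fun i => |v i|) S ∧
          ∃ t : ℕ, (t : ℝ) ≤ C * Real.log n ∧
            ∃ T : Finset (Fin n), T.Nonempty ∧
              WGraph.IsLevelSet
                ((G.walkMatrix ^ t) *ᵥ WGraph.ind S +
                  (G.walkMatrix ^ (t + 1)) *ᵥ WGraph.ind S) T ∧
              (T.card : ℝ) ≤ C * (δ * Real.log (1 / δ) * n) ∧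
              G.expansion T ≤ 1 - c := by
  -- With `ρ = 1 / 128`, the Cheeger loss `ρ ^ 2 / 16` is `1 / 2 ^ 18`.
  refine ⟨1 / 2 ^ 18, 2 ^ 18, by norm_num, by norm_num, ?_⟩
  intro n G hG δ hδ hδ2 v hv h2 h4
  obtain ⟨hs, h0, h1⟩ := WGraph.walkMatrix_properties hG
  have hn : 0 < n := by
    rcases Nat.eq_zero_or_pos n with rfl | h
    · simp at h2
    · exact h
  have hnR : (0 : ℝ) < n := by exact_mod_cast hn
  have hv1 : ∀ i, v i ^ 2 ≤ 1 := fun i => by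
    rw [← h2]
    exact Finset.single_le_sum (f := fun i => v i ^ 2) (fun i _ => sq_nonneg _)
      (Finset.mem_univ i)
  -- Needed so that `log n` is bounded below and absorbs the `+ 1` in `t ≤ j + 1`.
  have hn2 : (2 : ℝ) ≤ n := by
    have hle : ∑ i, |v i| ^ 4 ≤ 1 := by
      rw [← h2]
      refine Finset.sum_le_sum fun i _ => ?_
      have : |v i| ^ 4 = v i ^ 2 * v i ^ 2 := by
        rw [← sq_abs (v i)]
        ring
      rw [this]
      exact mul_le_of_le_one_left (sq_nonneg _) (hv1 i)
    have h := h4.trans hle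
    rw [div_le_one (by positivity)] at h
    nlinarith
  set τ : ℝ := √(1 / (2 * δ * n)) with hτdef
  have hτ : 0 < τ := Real.sqrt_pos.2 (by positivity)
  have hτ2 : τ ^ 2 = 1 / (2 * δ * n) := Real.sq_sqrt (by positivity)
  obtain ⟨S, j, t, hne, hS, htj, hlow, hstep⟩ :=
    WGraph.exists_levelSet_slow_decay hG hv h2 hτ (by
      refine le_of_eq_of_le ?_ h4
      rw [hτ2]
      field_simp)
  set A := G.walkMatrix with hA
  refine ⟨S, hne, ⟨2 ^ j * τ, by positivity, hS⟩, t, ?_, ?_⟩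
  · obtain ⟨i, hi⟩ := hne
    have hsq : (2 ^ j * τ) ^ 2 ≤ 1 := by
      refine (pow_le_pow_left₀ (by positivity) ((hS i).1 hi) 2).trans ?_
      rw [sq_abs]
      exact hv1 i
    have h2j : (2 : ℝ) ^ j ≤ n := by
      rw [mul_pow, hτ2, mul_one_div, div_le_one (by positivity)] at hsq
      have h1j : (1 : ℝ) ≤ 2 ^ j := one_le_pow₀ one_le_two
      nlinarith
    have hlog := Real.log_le_log (by positivity) h2j
    rw [Real.log_pow] at hlog
    have hlog2 := Real.log_le_log two_pos hn2
    have hl := Real.log_two_gt_d9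
    have ht : (t : ℝ) ≤ j + 1 := by exact_mod_cast htj
    have hj : (0 : ℝ) ≤ j := Nat.cast_nonneg j
    nlinarith
  · set x := (A ^ t) *ᵥ WGraph.ind S with hx
    have hx0 : ∀ i, 0 ≤ x i :=
      WGraph.mulVec_nonneg (WGraph.pow_entry_nonneg h0 t) (WGraph.ind_nonneg S)
    have hAx : (A ^ (t + 1)) *ᵥ WGraph.ind S = A *ᵥ x := by
      rw [hx, Matrix.mulVec_mulVec, ← pow_succ']
    rw [hAx]
    have hy0 := WGraph.mulVec_nonneg h0 hx0
    have hcpos : (0 : ℝ) < S.card := by exact_mod_cast hne.card_pos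
    have hff : x ⬝ᵥ x ≤ (x + A *ᵥ x) ⬝ᵥ (x + A *ᵥ x) :=
      WGraph.dotProduct_le_dotProduct hx0 hx0 (fun i => le_add_of_nonneg_right (hy0 i))
        fun i => le_add_of_nonneg_right (hy0 i)
    have hbig : (S.card : ℝ) ^ 2 ≤ 32 * (δ * n) * ((x + A *ᵥ x) ⬝ᵥ (x + A *ᵥ x)) := by
      rw [hτ2, one_div_mul_eq_div, div_le_iff₀ (by positivity)] at hlow
      have := mul_le_mul_of_nonneg_left hff (show 0 ≤ 32 * (δ * n) by positivity)
      linarith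
    have hfpos : 0 < (x + A *ᵥ x) ⬝ᵥ (x + A *ᵥ x) := by
      by_contra! hcon
      have h := mul_nonpos_of_nonneg_of_nonpos (show 0 ≤ 32 * (δ * n) by positivity) hcon
      nlinarith [sq_pos_of_pos hcpos]
    have hsum : ∑ i, (x + A *ᵥ x) i = 2 * S.card := by
      have e : ∑ i, x i = S.card := by
        rw [hx, WGraph.sum_mulVec (WGraph.pow_entry_symm hs t) (WGraph.pow_row_sum h1 t),
          WGraph.sum_ind]
      simp only [Pi.add_apply, Finset.sum_add_distrib, WGraph.sum_mulVec hs h1, e]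
      ring
    obtain ⟨θ, hθ, hT⟩ := WGraph.exists_levelSet_of_rayleigh hs h0 h1
      (f := x + A *ᵥ x) (fun i => add_nonneg (hx0 i) (hy0 i)) hfpos (by norm_num)
      (WGraph.rayleigh_add_mulVec hs h0 h1 hx0 hstep)
    set T := Finset.univ.filter fun i => θ ≤ (x + A *ᵥ x) i with hTdef
    have hTm : ∀ i, i ∈ T ↔ θ ≤ (x + A *ᵥ x) i := by simp [hTdef]
    obtain ⟨hcard, hexp⟩ := hT T hTm
    have hTne : T.Nonempty := by
      by_contra! he
      rw [he] at hexp
      simp [WGraph.ind, dotProduct] at hexp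
    refine ⟨T, hTne, ⟨θ, hθ, hTm⟩, ?_, ?_⟩
    · rw [hsum] at hcard
      -- `2 ^ 16 = 16 * 128 * 32`, from `4 * (2|S|) ^ 2`, `1 / ρ` and `hbig`. This already has no
      -- logarithm; `log (1 / δ) ≥ 1 / 2` recovers the stated form.
      have hTle : (T.card : ℝ) ≤ 2 ^ 16 * (δ * n) := by
        refine le_of_mul_le_mul_right ?_ hfpos
        linarith
      have hlog : 1 / 2 ≤ Real.log (1 / δ) := by
        have h := Real.log_le_log two_pos (show 2 ≤ 1 / δ by
          rw [le_div_iff₀ hδ]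
          linarith)
        linarith [Real.log_two_gt_d9]
      have hp : 0 < δ * n := by positivity
      nlinarith [mul_le_mul_of_nonneg_left hlog hp.le]
    · have hTpos : (0 : ℝ) < T.card := by exact_mod_cast hTne.card_pos
      rw [WGraph.expansion]
      have : 1 / 2 ^ 18 ≤ (WGraph.ind T ⬝ᵥ (A *ᵥ WGraph.ind T)) / (T.card : ℝ) := by
        rw [le_div_iff₀ hTpos]
        linarith
      linarith
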